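/- Let $R_2=\mathbb F_2[x_1,\dots,x_n]/(x_1^2-x_1,\dots,x_n^2-x_n)$. The class of $P\in R_2$ is the largest $c$ such that $x_c$ occurs in $P$ (and $0$ if $P$ is constant); a polynomial of class $c\ge 1$ is written $P=Ix_c+U$, where $I\neq 0$ (the initial) and $U$ only involve $x_1,\dots,x_{c-1}$. For a finite set $\mathcal P\subset R_2$, the procedure $\mathbf{TDTriSet}_2(\mathcal P)$ starts with $\mathcal A=\emptyset$, $\mathcal P^*=\emptyset$ and repeats the following. If $1\in\mathcal P$, return $(\emptyset,\mathcal P^*)$. If no nonzero polynomial is left in $\mathcal P$, return $(\mathcal A,\mathcal P^*)$. Otherwise let $\mathcal P_1\subseteq\mathcal P$ be the polynomials of the highest class $c$, choose any $Q=Ix_c+U\in\mathcal P_1$, and let $\mathcal R$ be the set of the nonzero pseudo-remainders $V+JU$ of the polynomials $Jx_c+V\in\mathcal P_1\setminus\{Q\}$ with respect to $x_c+U$. * If $I=1$: replace $\mathcal P$ by $\mathcal R\cup(\mathcal P\setminus\mathcal P_1)$ and $\mathcal A$ by $\mathcal A\cup\{Q\}$. * If $I\ne1$: add the set $(\mathcal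 P\setminus\{Q\})\cup\mathcal A\cup\{IU+I+U\}$ to $\mathcal P^*$, then replace $\mathcal P$ by $\mathcal R\cup\{I+1\}\cup(\mathcal P\setminus\mathcal P_1)$ and $\mathcal A$ by $\mathcal A\cup\{x_c+U\}$. The zero decomposition algorithm $\mathbf{TDCS}_2(\mathcal P)$ keeps a set of pending polynomial sets, initially $\{\mathcal P\}$. As long as it is nonempty, the algorithm removes any one of them, calls $\mathbf{TDTriSet}_2$ on it, adds the returned $\mathcal A$ (if nonempty) to its output and adds the elements of the returned $\mathcal P^*$ to the pending sets. The bitsize complexity is the number of bit operations (AND, XOR on coefficients) of the polynomial additions and multiplications, where a polynomial in $x_1,\dots,x_k$ is a vector of $2^k$ coefficient bits, so that an addition takes $2^k$ and a (schoolbook) multiplication takes $2\cdot 4^k$ bit operations. **Theorem.** Let $l=|\mathcal P|$ be the number of input polynomials. 1. The bitsize complexity of $\mathbf{TDCS}_2$ is $O(l^n)=O(2^{n\log_2 l})$, uniformly as long as $n$ is at most linear in $l$: for every $\kappa\in\mathbb N$ there is a constant $C$, depending only on $\kappa$, such that for all $n$ and all $\mathcal P\subset R_2$ with $n\le\kappa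 l$, every run of $\mathbf{TDCS}_2(\mathcal P)$, whatever choices are made, consists of $m$ steps (calls, rounds of $\mathbf{TDTriSet}_2$, and returns) with $t$ bit operations in total, where $m+t\le C\,l^n$ and $m+t\le C\,2^{n\log_2 l}$. In particular every run terminates. (For fixed $n\ge 1$, taking $\kappa=n$, this covers all nonempty $\mathcal P$, with a constant depending only on $n$.) 2. There is an absolute constant $C$ such that for all $n$ and all $\mathcal P\subset R_2$ with $l\ge4$, every run of $\mathbf{TDCS}_2(\mathcal P)$ takes at most $C\,(l+1)^n$ bit operations. -/

import Mathlib

/-! ### Boolean polynomials and bit-level arithmetic -/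

/-- An element of `R₂ = 𝔽₂[x₁,…,xₙ]/(x₁² - x₁,…,xₙ² - xₙ)`, given by the bit vector of the
coefficients of its unique multilinear representative: `P S` is the coefficient of the monomial
`∏_{i ∈ S} x_{i+1}`. -/
abbrev BoolPoly (n : ℕ) : Type := Finset (Fin n) → Bool

namespace BoolPoly

variable {n : ℕ}

/-- The zero polynomial. -/
def zero : BoolPoly n := fun _ => false

/-- The constant polynomial `1`. -/
def one : BoolPoly n := fun S => decide (S = ∅)

/-- The class of `P`: the largest `c` such that `x_c` occurs in `P`, and `0` for constants
(the element `i : Fin n` stands for the variable `x_{i+1}`). -/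
def cls (P : BoolPoly n) : ℕ :=
  (Finset.univ.filter fun S => P S = true).sup fun S => S.sup fun i => (i : ℕ) + 1

/-- The coefficient `I` in `P = I * x + U`, where `x` is the variable of index `v`. For `v` the
leading variable of `P` this is the initial of `P`. -/
def lead (v : Fin n) (P : BoolPoly n) : BoolPoly n :=
  fun S => decide (v ∉ S) && P (insert v S)

/-- The part `U` in `P = I * x + U`, where `x` is the variable of index `v`. -/
def rest (v : Fin n) (P : BoolPoly n) : BoolPoly n :=
  fun S => decide (v ∉ S) && P S

/-- The polynomial `x + U`, where `x` is the variable of index `v`. -/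
def monicOf (v : Fin n) (U : BoolPoly n) : BoolPoly n :=
  fun S => xor (decide (S = {v})) (U S)

/-- The `2 ^ k` monomials in the first `k` variables `x₁,…,x_k`. -/
def monomials (n k : ℕ) : Finset (Finset (Fin n)) :=
  (Finset.univ.filter fun i : Fin n => (i : ℕ) < k).powerset

end BoolPoly

/-- A result together with the number of bit operations spent to compute it. -/
structure Timed (α : Type) where
  val : α
  bits : ℕ

namespace Timed

instance : Monad Timed where
  pure a := ⟨a, 0⟩
  bind x f := ⟨(f x.val).val, x.bits + (f x.val).bits⟩

/-- Logical `and` of two bits: one bit operation. -/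
def bitAnd (a b : Bool) : Timed Bool := ⟨a && b, 1⟩

/-- Exclusive `or` of two bits: one bit operation. -/
def bitXor (a b : Bool) : Timed Bool := ⟨xor a b, 1⟩

end Timed

namespace BoolPoly

variable {n : ℕ}

/-- The sum of two polynomials in the variables `x₁,…,x_k`, computed bit by bit. -/
noncomputable def add (k : ℕ) (P Q : BoolPoly n) : Timed (BoolPoly n) :=
  (monomials n k).toList.foldlM (fun acc S => do
    let b ← Timed.bitXor (P S) (Q S)
    pure (Function.update acc S b)) zero

/-- The product of two polynomials in the variables `x₁,…,x_k`, computed by the schoolbook method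
(the product of the monomials `S` and `T` is the monomial `S ∪ T`, since `x² = x`); this takes
`2 * 4 ^ k` bit operations. -/
noncomputable def mul (k : ℕ) (P Q : BoolPoly n) : Timed (BoolPoly n) :=
  (monomials n k ×ˢ monomials n k).toList.foldlM (fun acc p => do
    let a ← Timed.bitAnd (P p.1) (Q p.2)
    let b ← Timed.bitXor (acc (p.1 ∪ p.2)) a
    pure (Function.update acc (p.1 ∪ p.2) b)) zero

/-- The pseudo-remainder `V + J * U` of `P = J * x + V` with respect to the monic polynomial
`x + U`, where `x` is the variable of index `v` and `J`, `V`, `U` only involve variables of smaller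
index. -/
noncomputable def prem (v : Fin n) (U P : BoolPoly n) : Timed (BoolPoly n) := do
  let M ← mul v (lead v P) U
  add v (rest v P) M

/-- The set of the nonzero pseudo-remainders of the elements of `S` with respect to `x + U`. -/
noncomputable def premSet (v : Fin n) (U : BoolPoly n) (S : Finset (BoolPoly n)) :
    Timed (Finset (BoolPoly n)) :=
  ⟨(S.image fun P => (prem v U P).val).erase zero, ∑ P ∈ S, (prem v U P).bits⟩

/-- The polynomial `I * U + I + U`, in the variables `x₁,…,x_k`. -/
noncomputable def joint (k : ℕ) (I U : BoolPoly n) : Timed (BoolPoly n) := do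
  let M ← mul k I U
  let A ← add k M I
  add k A U

end BoolPoly

/-! ### The well-ordering procedure `TDTriSet₂` -/

open BoolPoly in
/-- The elements of class `c` of a polynomial set. -/
def classPart {n : ℕ} (PS : Finset (BoolPoly n)) (c : ℕ) : Finset (BoolPoly n) :=
  PS.filter fun P => cls P = c

/-- The memory of `TDTriSet₂`: the current polynomial set, the triangular set built so far, and the
polynomial sets split off so far. -/
structure TriState (n : ℕ) where
  PS : Finset (BoolPoly n)
  A : Finset (BoolPoly n)
  PStar : Finset (Finset (BoolPoly n))

open BoolPoly in
/-- Elimination of the variable `x` of index `v` by means of the polynomial `Q = x + U`: the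
elements of the class of `x` are replaced by their nonzero pseudo-remainders (that of `Q` itself is
zero and is not computed). -/
noncomputable def TriState.monicRound {n : ℕ} (s : TriState n) (v : Fin n) (Q : BoolPoly n) :
    Timed (TriState n) :=
  let PS₁ := classPart s.PS ((v : ℕ) + 1)
  let R := premSet v (rest v Q) (PS₁.erase Q)
  { val :=
      { PS := R.val ∪ (s.PS \ PS₁)
        A := insert Q s.A
        PStar := s.PStar }
    bits := R.bits }

open BoolPoly in
/-- Elimination of the variable `x` of index `v` by means of `Q = I * x + U` with `I ≠ 1`: in the
case `I + 1 = 0` the polynomial `x + U` takes the place of `Q`; the case `I = U = 0`, that is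
`I * U + I + U = 0`, is split off. -/
noncomputable def TriState.splitRound {n : ℕ} (s : TriState n) (v : Fin n) (Q : BoolPoly n) :
    Timed (TriState n) :=
  let PS₁ := classPart s.PS ((v : ℕ) + 1)
  let I := lead v Q
  let U := rest v Q
  let R := premSet v U (PS₁.erase Q)
  let I₁ := add v I one
  let F := joint v I U
  { val :=
      { PS := R.val ∪ {I₁.val} ∪ (s.PS \ PS₁)
        A := insert (monicOf v U) s.A
        PStar := insert (s.PS.erase Q ∪ s.A ∪ {F.val}) s.PStar }
    bits := R.bits + I₁.bits + F.bits }

open BoolPoly in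
/-- One round of the loop of `TDTriSet₂`, with the number of bit operations of its polynomial
arithmetic: `1` is not in the current set, `x_{v+1}` is the highest variable occurring in it, and
`Q` is any element with this leading variable (over `𝔽₂` they all have degree one in it). -/
inductive TriStep {n : ℕ} : TriState n → ℕ → TriState n → Prop
  | monic (s : TriState n) (v : Fin n) (Q : BoolPoly n)
      (hone : one ∉ s.PS)
      (htop : ∀ P ∈ s.PS, cls P ≤ (v : ℕ) + 1)
      (hQ : Q ∈ classPart s.PS ((v : ℕ) + 1))
      (hI : lead v Q = one) :
      TriStep s (s.monicRound v Q).bits (s.monicRound v Q).val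
  | split (s : TriState n) (v : Fin n) (Q : BoolPoly n)
      (hone : one ∉ s.PS)
      (htop : ∀ P ∈ s.PS, cls P ≤ (v : ℕ) + 1)
      (hQ : Q ∈ classPart s.PS ((v : ℕ) + 1))
      (hI : lead v Q ≠ one) :
      TriStep s (s.splitRound v Q).bits (s.splitRound v Q).val

open BoolPoly in
/-- `TDTriSet₂` stops in the given state and returns the given triangular set (and the polynomial
sets split off so far). -/
inductive TriHalt {n : ℕ} : TriState n → Finset (BoolPoly n) → Prop
  /-- The current set contains the constant `1` and has no zero. -/
  | contradiction (s : TriState n) (hone : one ∈ s.PS) : TriHalt s ∅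
  /-- No polynomial is left (zero polynomials are void equations). -/
  | done (s : TriState n) (hPS : ∀ P ∈ s.PS, P = zero) : TriHalt s s.A

/-! ### The zero decomposition algorithm `TDCS₂` -/

/-- The memory of `TDCS₂`: the polynomial sets still to be treated, the running call of `TDTriSet₂`
(if any), and the monic triangular sets found so far. -/
structure CSState (n : ℕ) where
  pending : Finset (Finset (BoolPoly n))
  current : Option (TriState n)
  out : Finset (Finset (BoolPoly n))

/-- The start of `TDCS₂` with input `PS`. -/
def CSState.init {n : ℕ} (PS : Finset (BoolPoly n)) : CSState n :=
  { pending := {PS}, current := none, out := ∅ }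

/-- One step of `TDCS₂`, with the number of bit operations of its polynomial arithmetic. -/
inductive CSStep {n : ℕ} : CSState n → ℕ → CSState n → Prop
  /-- Choose a pending polynomial set and call `TDTriSet₂` on it. -/
  | call (pending out : Finset (Finset (BoolPoly n))) (QS : Finset (BoolPoly n))
      (hQS : QS ∈ pending) :
      CSStep ⟨pending, none, out⟩ 0 ⟨pending.erase QS, some ⟨QS, ∅, ∅⟩, out⟩
  /-- One round of the running call. -/
  | round (pending out : Finset (Finset (BoolPoly n))) (T T' : TriState n) (b : ℕ)
      (h : TriStep T b T') :
      CSStep ⟨pending, some T, out⟩ b ⟨pending, some T', out⟩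
  /-- The running call returns. -/
  | ret (pending out : Finset (Finset (BoolPoly n))) (T : TriState n) (A : Finset (BoolPoly n))
      (h : TriHalt T A) :
      CSStep ⟨pending, some T, out⟩ 0
        ⟨pending ∪ T.PStar, none, if A = ∅ then out else insert A out⟩

/-- `CSRun s m t s'`: the algorithm `TDCS₂` can get from `s` to `s'` in `m` steps whose polynomial
arithmetic takes `t` bit operations altogether. -/
inductive CSRun {n : ℕ} : CSState n → ℕ → ℕ → CSState n → Prop
  | refl (s : CSState n) : CSRun s 0 0 s
  | tail {s s' s'' : CSState n} {m t b : ℕ} (h : CSRun s m t s') (h' : CSStep s' b s'') :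
      CSRun s (m + 1) (t + b) s''

/-! ### Bit counts -/

/-! The proof is an amortized count on the tree of splittings. Suppose a set has at most `l`
elements of class at most `d`, of which `k` have class `d`, and is already monic and triangular
above `d`. A round that eliminates class `d` with `Q = I x + U` continues with a set living below
`d`. If `I ≠ 1`, it also splits off a set with only `k - 1` elements of class `d`, since `Q` gives
way to `I U + I + U`. In both sets at most one polynomial is added while `Q` leaves, so the bound
`l` survives. The elements of `A` carried into a split-off set are alone in their classes and have
initial `1`. Processing them again takes rounds, but no bit operations and no splitting.

This gives the recursion `bitBound_succ_right` for bits and `callBound_succ_right` for calls. Both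
stop at class one, whose only polynomials are `x` and `x + 1`, so that nothing splits there. A call
takes at most `n` rounds, plus its start and its return, because the highest class drops in each
round. With a price `a` per step, `setBound` is therefore a potential. `TriStep.roundKeeps` and
`CSStep.inv` show that every step pays for itself, whatever choices are made. The price `1` bounds
steps and bits together, hence forces termination; the price `0` bounds bits alone. Correctness of
the arithmetic is never needed, only classes, cardinalities and bit counts.

Solving the recursion gives `O((l+1)^n)` once `l + 1 > 4`, because the multiplication costs `4^d`
then grow more slowly than the tree. Finally `(1 + 1/l)^n ≤ exp (n/l) ≤ exp κ` replaces `l + 1` by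
`l`. -/

namespace Timed

variable {α β : Type}

theorem bits_bind (x : Timed α) (f : α → Timed β) :
    (x >>= f).bits = x.bits + (f x.val).bits := rfl

theorem val_bind (x : Timed α) (f : α → Timed β) : (x >>= f).val = (f x.val).val := rfl

theorem bits_pure (a : α) : (pure a : Timed α).bits = 0 := rfl

theorem val_pure (a : α) : (pure a : Timed α).val = a := rfl

theorem bits_foldlM (f : β → α → Timed β) (c : ℕ) (h : ∀ b a, (f b a).bits = c) (L : List α) :
    ∀ b, (L.foldlM f b).bits = c * L.length := by
  induction L with
  | nil => intro b; simp [bits_pure]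
  | cons a L ih =>
    intro b
    rw [List.foldlM_cons, bits_bind, h, ih, List.length_cons]
    ring

theorem val_foldlM_induction (f : β → α → Timed β) (p : β → Prop) (L : List α)
    (h : ∀ b, p b → ∀ a ∈ L, p (f b a).val) : ∀ b, p b → p (L.foldlM f b).val := by
  induction L with
  | nil => intro b hb; simpa [val_pure] using hb
  | cons a L ih =>
    intro b hb
    rw [List.foldlM_cons, val_bind]
    exact ih (fun b hb a ha => h b hb a (List.mem_cons_of_mem _ ha)) _
      (h b hb a List.mem_cons_self)

end Timed

namespace BoolPoly

variable {n : ℕ}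

theorem card_monomials_le (n k : ℕ) : (monomials n k).card ≤ 2 ^ k := by
  rw [monomials, Finset.card_powerset]
  refine Nat.pow_le_pow_right (by norm_num) ?_
  calc (Finset.univ.filter fun i : Fin n => (i : ℕ) < k).card
      ≤ (Finset.range k).card :=
        Finset.card_le_card_of_injOn (fun i : Fin n => (i : ℕ))
          (fun i hi => by simpa using hi) (fun i _ j _ h => Fin.ext h)
    _ = k := Finset.card_range k

theorem bits_add_le (k : ℕ) (P Q : BoolPoly n) : (add k P Q).bits ≤ 2 ^ k := by
  rw [add, Timed.bits_foldlM _ 1 (fun _ _ => rfl), one_mul, Finset.length_toList]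
  exact card_monomials_le n k

theorem bits_mul_le (k : ℕ) (P Q : BoolPoly n) : (mul k P Q).bits ≤ 2 * 4 ^ k := by
  rw [mul, Timed.bits_foldlM _ 2 (fun _ _ => rfl), Finset.length_toList, Finset.card_product]
  have h := card_monomials_le n k
  have h4 : (4 : ℕ) ^ k = 2 ^ k * 2 ^ k := by rw [← mul_pow]; norm_num
  rw [h4]
  exact Nat.mul_le_mul_left 2 (Nat.mul_le_mul h h)

theorem two_pow_le_four_pow (k : ℕ) : 2 ^ k ≤ 4 ^ k := Nat.pow_le_pow_left (by norm_num) k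

theorem bits_prem_le (v : Fin n) (U P : BoolPoly n) : (prem v U P).bits ≤ 3 * 4 ^ (v : ℕ) := by
  have h1 := bits_mul_le v (lead v P) U
  have h2 := bits_add_le v (rest v P) (mul v (lead v P) U).val
  have h3 := two_pow_le_four_pow (v : ℕ)
  rw [prem, Timed.bits_bind]
  omega

theorem bits_joint_le (k : ℕ) (I U : BoolPoly n) : (joint k I U).bits ≤ 4 * 4 ^ k := by
  have h1 := bits_mul_le k I U
  have h2 := bits_add_le k (mul k I U).val I
  have h3 := bits_add_le k (add k (mul k I U).val I).val U
  have h4 := two_pow_le_four_pow k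
  rw [joint, Timed.bits_bind, Timed.bits_bind]
  omega

theorem bits_premSet_le (v : Fin n) (U : BoolPoly n) (S : Finset (BoolPoly n)) :
    (premSet v U S).bits ≤ S.card * (3 * 4 ^ (v : ℕ)) := by
  rw [← smul_eq_mul]
  exact Finset.sum_le_card_nsmul _ _ _ fun P _ => bits_prem_le v U P

/-! ### Classes -/

theorem cls_le_iff {P : BoolPoly n} {c : ℕ} :
    cls P ≤ c ↔ ∀ S, P S = true → ∀ i ∈ S, (i : ℕ) + 1 ≤ c := by
  simp [cls, Finset.sup_le_iff]

theorem cls_le (P : BoolPoly n) : cls P ≤ n :=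
  cls_le_iff.2 fun _ _ i _ => i.2

/-- `add` writes only to coefficients of monomials in the first `k` variables. The bound thus needs
nothing about the summands. -/
theorem cls_add_le (k : ℕ) (P Q : BoolPoly n) : cls (add k P Q).val ≤ k := by
  rw [cls_le_iff]
  refine Timed.val_foldlM_induction _
    (fun R : BoolPoly n => ∀ S, R S = true → ∀ i ∈ S, (i : ℕ) + 1 ≤ k) _ ?_ _ ?_
  · intro R hR T hT S hS i hi
    by_cases h : S = T
    · subst h
      rw [Finset.mem_toList, monomials, Finset.mem_powerset] at hT
      have := hT hi
      simp only [Finset.mem_filter] at this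
      exact this.2
    · refine hR S ?_ i hi
      simpa [Timed.val_bind, Timed.val_pure, Function.update_of_ne h] using hS
  · intro S hS
    simp [zero] at hS

theorem cls_prem_le (v : Fin n) (U P : BoolPoly n) : cls (prem v U P).val ≤ v :=
  cls_add_le _ _ _

theorem cls_joint_le (k : ℕ) (I U : BoolPoly n) : cls (joint k I U).val ≤ k :=
  cls_add_le _ _ _

theorem cls_le_of_mem_premSet {v : Fin n} {U P : BoolPoly n} {S : Finset (BoolPoly n)}
    (h : P ∈ (premSet v U S).val) : cls P ≤ v := by
  obtain ⟨Q, -, rfl⟩ := Finset.mem_image.1 (Finset.mem_of_mem_erase h)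
  exact cls_prem_le v U Q

theorem card_premSet_le (v : Fin n) (U : BoolPoly n) (S : Finset (BoolPoly n)) :
    (premSet v U S).val.card ≤ S.card :=
  (Finset.card_erase_le).trans Finset.card_image_le

theorem insert_eq_singleton_iff {v : Fin n} {S : Finset (Fin n)} (hv : v ∉ S) :
    insert v S = {v} ↔ S = ∅ := by
  constructor
  · intro h
    rw [Finset.eq_empty_iff_forall_notMem]
    intro i hi
    have h1 : i ∈ ({v} : Finset (Fin n)) := h ▸ Finset.mem_insert_of_mem hi
    rw [Finset.mem_singleton] at h1
    exact hv (h1 ▸ hi)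
  · rintro rfl; rfl

theorem lead_monicOf_rest (v : Fin n) (Q : BoolPoly n) :
    lead v (monicOf v (rest v Q)) = one := by
  funext S
  by_cases hv : v ∈ S
  · have hS : S ≠ ∅ := Finset.ne_empty_of_mem hv
    simp [lead, one, hv, hS]
  · simp [lead, monicOf, rest, one, hv, insert_eq_singleton_iff hv]

theorem cls_monicOf_rest {v : Fin n} {Q : BoolPoly n} (h : cls Q ≤ (v : ℕ) + 1) :
    cls (monicOf v (rest v Q)) = (v : ℕ) + 1 := by
  refine le_antisymm (cls_le_iff.2 fun S hS i hi => ?_) ?_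
  · by_cases hSv : S = {v}
    · subst hSv
      rw [Finset.mem_singleton] at hi
      rw [hi]
    · refine cls_le_iff.1 h S ?_ i hi
      simp only [monicOf, rest, hSv] at hS
      simp at hS
      exact hS.2
  · exact cls_le_iff.1 (le_refl (cls (monicOf v (rest v Q)))) {v} (by simp [monicOf, rest]) v
      (Finset.mem_singleton_self v)

/-! ### Polynomials in the lowest variable. -/

theorem eq_empty_or_eq_singleton {v : Fin n} (hv : (v : ℕ) = 0) {P : BoolPoly n} (h : cls P ≤ 1)
    {S : Finset (Fin n)} (hS : P S = true) : S = ∅ ∨ S = {v} := by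
  rw [← Finset.subset_singleton_iff]
  intro i hi
  have := cls_le_iff.1 h S hS i hi
  rw [Finset.mem_singleton]
  exact Fin.ext (by omega)

theorem apply_singleton_of_cls_eq_one {v : Fin n} (hv : (v : ℕ) = 0) {P : BoolPoly n}
    (h : cls P = 1) : P {v} = true := by
  by_contra hP
  have : cls P ≤ 0 := cls_le_iff.2 fun S hS i hi => by
    rcases eq_empty_or_eq_singleton hv h.le hS with rfl | rfl
    · simp at hi
    · exact absurd hS hP
  omega

theorem lead_eq_one_of_cls_eq_one {v : Fin n} (hv : (v : ℕ) = 0) {P : BoolPoly n}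
    (h : cls P = 1) : lead v P = one := by
  funext S
  by_cases hvS : v ∈ S
  · have hS : S ≠ ∅ := Finset.ne_empty_of_mem hvS
    simp [lead, one, hvS, hS]
  · by_cases hS : S = ∅
    · subst hS
      simpa [lead, one] using apply_singleton_of_cls_eq_one hv h
    · have : P (insert v S) = false := by
        by_contra hP
        rcases eq_empty_or_eq_singleton hv h.le (by simpa using hP) with h1 | h1
        · exact Finset.insert_ne_empty _ _ h1
        · exact hS ((insert_eq_singleton_iff hvS).1 h1)
      simp [lead, one, hS, this]

/-- Only `x` and `x + 1` have class one, and the constant coefficient tells them apart. -/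
theorem card_classPart_one_le (v : Fin n) (hv : (v : ℕ) = 0) (PS : Finset (BoolPoly n)) :
    (classPart PS 1).card ≤ 2 := by
  refine (Finset.card_le_card_of_injOn (t := Finset.univ) (fun P : BoolPoly n => P ∅)
    (fun _ _ => Finset.mem_coe.2 (Finset.mem_univ _)) ?_).trans (by simp)
  intro P hP Q hQ hPQ
  have hP1 : cls P = 1 := (Finset.mem_filter.1 (Finset.mem_coe.1 hP)).2
  have hQ1 : cls Q = 1 := (Finset.mem_filter.1 (Finset.mem_coe.1 hQ)).2
  have hP2 := apply_singleton_of_cls_eq_one hv hP1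
  have hQ2 := apply_singleton_of_cls_eq_one hv hQ1
  funext S
  by_cases h0 : S = ∅
  · rw [h0]; exact hPQ
  by_cases h1 : S = {v}
  · rw [h1, hP2, hQ2]
  have e : ∀ R : BoolPoly n, cls R = 1 → R S = false := fun R hR => by
    by_contra hS
    rcases eq_empty_or_eq_singleton hv hR.le (by simpa using hS) with h | h
    exacts [h0 h, h1 h]
  rw [e P hP1, e Q hQ1]

end BoolPoly

/-! ### Potentials -/

/-- Bound for the bit operations spent on a polynomial set all of whose parts have at most `l`
elements, with `k` elements in the class `d`, below which nothing has been eliminated. -/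
def bitBound (l : ℕ) : ℕ → ℕ → ℕ
  | 0, _ => 0
  | 1, _ => 3
  | d + 2, k => (k + 1) * bitBound l (d + 1) l + k * (5 * 4 ^ (d + 1) * l)

/-- Bound for the number of calls of `TDTriSet₂` caused by such a polynomial set. -/
def callBound (l : ℕ) : ℕ → ℕ → ℕ
  | 0, _ => 1
  | 1, _ => 1
  | d + 2, k => (k + 1) * (l + 1) ^ d

theorem callBound_succ (l d k : ℕ) :
    callBound l (d + 2) k = (k + 1) * callBound l (d + 1) l := by
  cases d with
  | zero => simp [callBound]
  | succ d => simp [callBound, pow_succ]; ring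

theorem bitBound_le_succ (l d k : ℕ) : bitBound l d l ≤ bitBound l (d + 1) k := by
  cases d with
  | zero => simp [bitBound]
  | succ d =>
    rw [bitBound]
    exact (Nat.le_mul_of_pos_left _ k.succ_pos).trans (Nat.le_add_right _ _)

theorem callBound_le_succ (l d k : ℕ) : callBound l d l ≤ callBound l (d + 1) k := by
  cases d with
  | zero => simp [callBound]
  | succ d =>
    rw [callBound_succ]
    exact Nat.le_mul_of_pos_left _ k.succ_pos

theorem bitBound_le (l k : ℕ) {c d : ℕ} (h : c < d) : bitBound l c l ≤ bitBound l d k := by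
  obtain ⟨e, rfl⟩ := Nat.exists_eq_succ_of_ne_zero (Nat.ne_zero_of_lt h)
  exact (monotone_nat_of_le_succ (f := fun d => bitBound l d l)
    (fun d => bitBound_le_succ l d l) (Nat.lt_succ_iff.1 h)).trans (bitBound_le_succ l e k)

theorem callBound_le (l k : ℕ) {c d : ℕ} (h : c < d) : callBound l c l ≤ callBound l d k := by
  obtain ⟨e, rfl⟩ := Nat.exists_eq_succ_of_ne_zero (Nat.ne_zero_of_lt h)
  exact (monotone_nat_of_le_succ (f := fun d => callBound l d l)
    (fun d => callBound_le_succ l d l) (Nat.lt_succ_iff.1 h)).trans (callBound_le_succ l e k)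

/-- The cost of one elimination in class `d + 2`: the split-off set, the continued set below, and
the arithmetic on polynomials in `d + 1` variables. -/
theorem bitBound_succ_right (l d k : ℕ) : bitBound l (d + 2) (k + 1) =
    bitBound l (d + 2) k + bitBound l (d + 1) l + 5 * 4 ^ (d + 1) * l := by
  rw [bitBound, bitBound]; ring

theorem callBound_succ_right (l d k : ℕ) : callBound l (d + 2) (k + 1) =
    callBound l (d + 2) k + callBound l (d + 1) l := by
  rw [callBound_succ, callBound_succ]; ring

theorem callBound_pos (l d k : ℕ) : 0 < callBound l d k := by
  rcases d with _ | _ | d <;> simp [callBound]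

/-! ### Partly triangular sets and their weights. -/

open BoolPoly

variable {n : ℕ}

/-- The polynomial set is triangular with initials `1` above the class `d`, has at most `l`
elements of class at most `d`, and at most `k` elements of class `d`. -/
structure TriangularAbove (l d k : ℕ) (PS : Finset (BoolPoly n)) : Prop where
  low : (PS.filter fun P => cls P ≤ d).card ≤ l
  top : (classPart PS d).card ≤ k
  monic : ∀ v : Fin n, d ≤ v → ∀ P ∈ PS, cls P = (v : ℕ) + 1 → lead v P = one
  unique : ∀ P ∈ PS, ∀ Q ∈ PS, d < cls P → cls P = cls Q → P = Q

theorem TriangularAbove.of_low {l d : ℕ} {PS : Finset (BoolPoly n)}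
    (low : (PS.filter fun P => cls P ≤ d).card ≤ l)
    (monic : ∀ v : Fin n, d ≤ v → ∀ P ∈ PS, cls P = (v : ℕ) + 1 → lead v P = one)
    (unique : ∀ P ∈ PS, ∀ Q ∈ PS, d < cls P → cls P = cls Q → P = Q) :
    TriangularAbove l d l PS :=
  ⟨low, (Finset.card_le_card (Finset.monotone_filter_right _ fun _ _ h => le_of_eq h)).trans low,
    monic, unique⟩

theorem triangularAbove_self (PS : Finset (BoolPoly n)) :
    TriangularAbove PS.card n PS.card PS :=
  .of_low (Finset.card_filter_le _ _) (fun v hv => absurd v.2 (not_lt.2 hv))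
    (fun P _ _ _ h => absurd (cls_le P) (not_le.2 h))

/-- Bound for `a` times the number of steps plus the number of bit operations. -/
def setBound (n a l d k : ℕ) : ℕ := bitBound l d k + a * (n + 2) * callBound l d k

/-- The least bound available for the cost of a polynomial set. -/
noncomputable def weight (a l : ℕ) (PS : Finset (BoolPoly n)) : ℕ :=
  sInf {w | ∃ d k, TriangularAbove l d k PS ∧ w = setBound n a l d k}

theorem weight_le {a l d k : ℕ} {PS : Finset (BoolPoly n)} (h : TriangularAbove l d k PS) :
    weight a l PS ≤ setBound n a l d k :=
  Nat.sInf_le ⟨d, k, h, rfl⟩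

/-- The weight depends on the set alone, so weights can be summed over finsets of polynomial sets.
The hypothesis excludes the default value `0` of an empty infimum; otherwise the infimum is
attained. -/
theorem exists_setBound_eq_weight (a : ℕ) {l d k : ℕ} {PS : Finset (BoolPoly n)}
    (h : TriangularAbove l d k PS) :
    ∃ d k, TriangularAbove l d k PS ∧ weight a l PS = setBound n a l d k :=
  Nat.sInf_mem (s := {w | ∃ d k, TriangularAbove l d k PS ∧ w = setBound n a l d k})
    ⟨_, d, k, h, rfl⟩

/-- The highest class of a polynomial set. -/
def height (PS : Finset (BoolPoly n)) : ℕ := PS.sup cls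

theorem height_le_of {PS : Finset (BoolPoly n)} {c : ℕ} (h : ∀ P ∈ PS, cls P ≤ c) :
    height PS ≤ c := Finset.sup_le h

theorem le_height {PS : Finset (BoolPoly n)} {P : BoolPoly n} (h : P ∈ PS) :
    cls P ≤ height PS := Finset.le_sup (f := cls) h

theorem height_le (PS : Finset (BoolPoly n)) : height PS ≤ n := height_le_of fun P _ => cls_le P

theorem height_lt_height {PS : Finset (BoolPoly n)} {v : Fin n} {Q : BoolPoly n}
    (hQ : Q ∈ classPart PS ((v : ℕ) + 1))
    {PS' : Finset (BoolPoly n)} (h : ∀ P ∈ PS', cls P ≤ v) : height PS' < height PS := by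
  have := le_height (Finset.mem_filter.1 hQ).1
  have h2 := (Finset.mem_filter.1 hQ).2
  have := height_le_of h
  omega

/-- Invariant of the memory of `TDTriSet₂` while it treats the classes up to `d`. -/
structure TriState.Inv (l d k : ℕ) (T : TriState n) : Prop where
  tri : TriangularAbove l d k (T.PS ∪ T.A)
  above : ∀ P ∈ T.A, d < cls P

/-- Bound for the cost of the rest of a running call and the calls that it causes, apart from the
polynomial sets already split off. -/
def TriState.bound (a l d k : ℕ) (T : TriState n) : ℕ :=
  bitBound l d k + a * ((n + 2) * (callBound l d k - 1) + height T.PS + 1)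

theorem Finset.sum_insert_le_nat {α : Type*} [DecidableEq α] (f : α → ℕ) (a : α) (s : Finset α) :
    ∑ x ∈ insert a s, f x ≤ f a + ∑ x ∈ s, f x := by
  by_cases h : a ∈ s
  · rw [Finset.insert_eq_of_mem h]; omega
  · rw [Finset.sum_insert h]

/-! ### One round of `TDTriSet₂` -/

/-- This handles skipped classes: no element of `T.PS ∪ T.A` has class in `(c, d]`, so the
triangular part may be taken to start above `c`. -/
theorem TriState.Inv.lower {l d k c : ℕ} {T : TriState n} (h : T.Inv l d k) (hcd : c ≤ d)
    (htop : ∀ P ∈ T.PS, cls P ≤ c) : T.Inv l c l := by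
  have key : ∀ P ∈ T.PS ∪ T.A, c < cls P → d < cls P := fun P hP hc => by
    rcases Finset.mem_union.1 hP with hP | hP
    · exact absurd (htop P hP) (not_le.2 hc)
    · exact h.above P hP
  refine ⟨.of_low ((Finset.card_le_card ?_).trans h.tri.low) ?_ ?_, fun P hP =>
    hcd.trans_lt (h.above P hP)⟩
  · exact Finset.monotone_filter_right _ fun P _ hP => le_trans hP hcd
  · intro w hw P hP hPw
    have := key P hP (by omega)
    exact h.tri.monic w (by omega) P hP hPw
  · exact fun P hP Q hQ hc => h.tri.unique P hP Q hQ (key P hP hc)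

theorem TriState.Inv.eliminate {l k : ℕ} {v : Fin n} {T : TriState n}
    (h : T.Inv l ((v : ℕ) + 1) k) {M : BoolPoly n} (hM : cls M = (v : ℕ) + 1)
    (hlead : lead v M = one) {PS' : Finset (BoolPoly n)} (hPS' : ∀ P ∈ PS', cls P ≤ v)
    (hcard : PS'.card ≤ l) (S : Finset (Finset (BoolPoly n))) :
    TriState.Inv l v l ⟨PS', insert M T.A, S⟩ := by
  have key : ∀ P ∈ PS' ∪ insert M T.A, (v : ℕ) < cls P → P = M ∨ P ∈ T.A := fun P hP hv => by
    rcases Finset.mem_union.1 hP with hP | hP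
    · exact absurd (hPS' P hP) (not_le.2 hv)
    · exact Finset.mem_insert.1 hP
  have above : ∀ P ∈ insert M T.A, (v : ℕ) < cls P := fun P hP => by
    rcases Finset.mem_insert.1 hP with rfl | hP
    · omega
    · have := h.above P hP
      omega
  refine ⟨.of_low ((Finset.card_le_card fun P hP => ?_).trans hcard) ?_ ?_, above⟩
  · obtain ⟨hP, hv⟩ := Finset.mem_filter.1 hP
    rcases Finset.mem_union.1 hP with hP | hP
    · exact hP
    · exact absurd (above P hP) (not_lt.2 hv)
  · intro w hw P hP hPw
    rcases key P hP (by omega) with rfl | hP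
    · obtain rfl : w = v := Fin.ext (by omega)
      exact hlead
    · have := h.above P hP
      exact h.tri.monic w (by omega) P (Finset.mem_union_right _ hP) hPw
  · intro P hP Q hQ hc hPQ
    rcases key P hP hc with rfl | hPA <;> rcases key Q hQ (by omega) with rfl | hQA
    · rfl
    · have := h.above Q hQA
      omega
    · have := h.above P hPA
      omega
    · exact h.tri.unique P (Finset.mem_union_right _ hPA) Q (Finset.mem_union_right _ hQA)
        (h.above P hPA) hPQ

/-! ### Effect and cost of eliminating the highest class. -/

section Top

variable {l k : ℕ} {v : Fin n} {T : TriState n} {Q : BoolPoly n}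

theorem TriState.Inv.card_PS_le (h : T.Inv l ((v : ℕ) + 1) k)
    (htop : ∀ P ∈ T.PS, cls P ≤ (v : ℕ) + 1) : T.PS.card ≤ l :=
  (Finset.card_le_card fun P hP =>
    Finset.mem_filter.2 ⟨Finset.mem_union_left _ hP, htop P hP⟩).trans h.tri.low

theorem TriState.Inv.card_classPart_le (h : T.Inv l ((v : ℕ) + 1) k) :
    (classPart T.PS ((v : ℕ) + 1)).card ≤ k :=
  (Finset.card_le_card (Finset.filter_subset_filter _ Finset.subset_union_left)).trans h.tri.top

/-- `Q` leaves no remainder. The free place is what `I + 1` occupies in a splitting round. -/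
theorem card_premSet_union_add_one_le (hQ : Q ∈ classPart T.PS ((v : ℕ) + 1)) :
    ((premSet v (rest v Q) ((classPart T.PS ((v : ℕ) + 1)).erase Q)).val ∪
      (T.PS \ classPart T.PS ((v : ℕ) + 1))).card + 1 ≤ T.PS.card := by
  have h1 := card_premSet_le v (rest v Q) ((classPart T.PS ((v : ℕ) + 1)).erase Q)
  have h2 := Finset.card_erase_add_one hQ
  have h3 := Finset.card_sdiff_add_card_eq_card
    (Finset.filter_subset (fun P => cls P = (v : ℕ) + 1) T.PS)
  have h4 := Finset.card_union_le
    (premSet v (rest v Q) ((classPart T.PS ((v : ℕ) + 1)).erase Q)).val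
    (T.PS \ classPart T.PS ((v : ℕ) + 1))
  simp only [classPart] at *
  omega

theorem cls_le_of_mem_sdiff_classPart (htop : ∀ P ∈ T.PS, cls P ≤ (v : ℕ) + 1) {P : BoolPoly n}
    (hP : P ∈ T.PS \ classPart T.PS ((v : ℕ) + 1)) : cls P ≤ v := by
  obtain ⟨h1, h2⟩ := Finset.mem_sdiff.1 hP
  have h3 := htop P h1
  have h4 : cls P ≠ (v : ℕ) + 1 := fun h => h2 (Finset.mem_filter.2 ⟨h1, h⟩)
  omega

theorem cls_le_of_mem_monicRound (htop : ∀ P ∈ T.PS, cls P ≤ (v : ℕ) + 1) :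
    ∀ P ∈ (T.monicRound v Q).val.PS, cls P ≤ v := fun P hP => by
  rcases Finset.mem_union.1 hP with hP | hP
  · exact cls_le_of_mem_premSet hP
  · exact cls_le_of_mem_sdiff_classPart htop hP

theorem cls_le_of_mem_splitRound (htop : ∀ P ∈ T.PS, cls P ≤ (v : ℕ) + 1) :
    ∀ P ∈ (T.splitRound v Q).val.PS, cls P ≤ v := fun P hP => by
  rcases Finset.mem_union.1 hP with hP | hP
  · rcases Finset.mem_union.1 hP with hP | hP
    · exact cls_le_of_mem_premSet hP
    · rw [Finset.mem_singleton.1 hP]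
      exact cls_add_le _ _ _
  · exact cls_le_of_mem_sdiff_classPart htop hP

theorem TriState.Inv.monicRound (h : T.Inv l ((v : ℕ) + 1) k)
    (htop : ∀ P ∈ T.PS, cls P ≤ (v : ℕ) + 1) (hQ : Q ∈ classPart T.PS ((v : ℕ) + 1))
    (hI : lead v Q = one) : (T.monicRound v Q).val.Inv l v l := by
  have h1 := card_premSet_union_add_one_le hQ
  have h2 := h.card_PS_le htop
  refine h.eliminate (Finset.mem_filter.1 hQ).2 hI (cls_le_of_mem_monicRound (Q := Q) htop) ?_ _
  change ((premSet v (rest v Q) ((classPart T.PS ((v : ℕ) + 1)).erase Q)).val ∪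
      (T.PS \ classPart T.PS ((v : ℕ) + 1))).card ≤ l
  omega

theorem TriState.Inv.splitRound (h : T.Inv l ((v : ℕ) + 1) k)
    (htop : ∀ P ∈ T.PS, cls P ≤ (v : ℕ) + 1) (hQ : Q ∈ classPart T.PS ((v : ℕ) + 1)) :
    (T.splitRound v Q).val.Inv l v l := by
  have h1 := card_premSet_union_add_one_le hQ
  have h2 := h.card_PS_le htop
  refine h.eliminate (cls_monicOf_rest (Finset.mem_filter.1 hQ).2.le) (lead_monicOf_rest v Q)
    (cls_le_of_mem_splitRound (Q := Q) htop) ?_ _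
  have h3 : (T.splitRound v Q).val.PS =
      (premSet v (rest v Q) ((classPart T.PS ((v : ℕ) + 1)).erase Q)).val ∪
      (T.PS \ classPart T.PS ((v : ℕ) + 1)) ∪ {(add v (lead v Q) one).val} :=
    Finset.union_right_comm _ _ _
  rw [h3]
  refine (Finset.card_union_le _ _).trans ?_
  rw [Finset.card_singleton]
  omega

/-- Exchanging `Q` for a polynomial `F` of lower class lowers the count in the top class by one and
does not raise the total. `T.A` lies strictly above and only contributes to the triangular part. -/
theorem TriState.Inv.triangularAbove_split (h : T.Inv l ((v : ℕ) + 1) (k + 1))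
    (htop : ∀ P ∈ T.PS, cls P ≤ (v : ℕ) + 1) (hQ : Q ∈ classPart T.PS ((v : ℕ) + 1))
    {F : BoolPoly n} (hF : cls F ≤ v) :
    TriangularAbove l ((v : ℕ) + 1) k (T.PS.erase Q ∪ T.A ∪ {F}) := by
  have hQPS := (Finset.mem_filter.1 hQ).1
  have key : ∀ P ∈ T.PS.erase Q ∪ T.A ∪ {F}, (v : ℕ) + 1 < cls P → P ∈ T.A := fun P hP hv => by
    simp only [Finset.mem_union, Finset.mem_singleton] at hP
    rcases hP with (hP | hP) | rfl
    · exact absurd (htop P (Finset.mem_of_mem_erase hP)) (not_le.2 hv)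
    · exact hP
    · omega
  refine ⟨?_, ?_, ?_, ?_⟩
  · have h1 : ((T.PS.erase Q ∪ T.A ∪ {F}).filter fun P => cls P ≤ (v : ℕ) + 1) ⊆
        T.PS.erase Q ∪ {F} := fun P hP => by
      simp only [Finset.mem_filter, Finset.mem_union] at hP ⊢
      rcases hP with ⟨(hP | hP) | hP, hc⟩
      · exact Or.inl hP
      · exact absurd (h.above P hP) (not_lt.2 hc)
      · exact Or.inr hP
    have h2 := Finset.card_union_le (T.PS.erase Q) {F}
    have h3 := Finset.card_erase_add_one hQPS
    have h4 := h.card_PS_le htop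
    have h5 := Finset.card_le_card h1
    rw [Finset.card_singleton] at h2
    omega
  · have h1 : classPart (T.PS.erase Q ∪ T.A ∪ {F}) ((v : ℕ) + 1) ⊆
        (classPart T.PS ((v : ℕ) + 1)).erase Q := fun P hP => by
      simp only [classPart, Finset.mem_filter, Finset.mem_union, Finset.mem_erase,
        Finset.mem_singleton] at hP ⊢
      rcases hP with ⟨(hP | hP) | rfl, hc⟩
      · exact ⟨hP.1, hP.2, hc⟩
      · exact absurd (h.above P hP) (by omega)
      · omega
    have h2 := Finset.card_erase_add_one hQ
    have h3 := h.card_classPart_le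
    have h4 := Finset.card_le_card h1
    omega
  · intro w hw P hP hPw
    exact h.tri.monic w hw P (Finset.mem_union_right _ (key P hP (by omega))) hPw
  · intro P hP P' hP' hc hPP'
    exact h.tri.unique P (Finset.mem_union_right _ (key P hP hc)) P'
      (Finset.mem_union_right _ (key P' hP' (by omega))) hc hPP'

theorem bits_monicRound_le (hQ : Q ∈ classPart T.PS ((v : ℕ) + 1)) :
    (T.monicRound v Q).bits ≤ ((classPart T.PS ((v : ℕ) + 1)).card - 1) * (3 * 4 ^ (v : ℕ)) := by
  rw [← Finset.card_erase_of_mem hQ]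
  exact bits_premSet_le _ _ _

/-- In units of `4 ^ v`, each remainder costs at most `3`. Computing `I + 1` and `I U + I + U` costs
at most `1 + 4`, which is charged to `Q`. -/
theorem bits_splitRound_le (hQ : Q ∈ classPart T.PS ((v : ℕ) + 1)) :
    (T.splitRound v Q).bits ≤ (classPart T.PS ((v : ℕ) + 1)).card * (5 * 4 ^ (v : ℕ)) := by
  have h1 := bits_premSet_le v (rest v Q) ((classPart T.PS ((v : ℕ) + 1)).erase Q)
  have h2 := bits_add_le v (lead v Q) one
  have h3 := bits_joint_le v (lead v Q) (rest v Q)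
  have h4 := two_pow_le_four_pow (v : ℕ)
  rw [← Finset.card_erase_add_one hQ, add_one_mul]
  have h5 : ((classPart T.PS ((v : ℕ) + 1)).erase Q).card * (3 * 4 ^ (v : ℕ)) ≤
      ((classPart T.PS ((v : ℕ) + 1)).erase Q).card * (5 * 4 ^ (v : ℕ)) :=
    Nat.mul_le_mul_left _ (Nat.mul_le_mul_right _ (by norm_num))
  change _ + _ + _ ≤ _
  omega

/-- By uniqueness `Q` is alone in its class, so no remainder is computed and `Q` merely moves from
`PS` to `A`. -/
theorem TriState.Inv.monicRound_above {d : ℕ} (h : T.Inv l d k) (hd : d < (v : ℕ) + 1)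
    (hQ : Q ∈ classPart T.PS ((v : ℕ) + 1)) :
    (T.monicRound v Q).bits = 0 ∧ (T.monicRound v Q).val.Inv l d k := by
  obtain ⟨hQPS, hQc⟩ := Finset.mem_filter.1 hQ
  have h1 : classPart T.PS ((v : ℕ) + 1) = {Q} := by
    refine Finset.eq_singleton_iff_unique_mem.2 ⟨hQ, fun P hP => ?_⟩
    obtain ⟨hP, hPc⟩ := Finset.mem_filter.1 hP
    exact h.tri.unique P (Finset.mem_union_left _ hP) Q (Finset.mem_union_left _ hQPS)
      (by omega) (by omega)
  have h2 : (T.monicRound v Q).val.PS ∪ (T.monicRound v Q).val.A = T.PS ∪ T.A := by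
    simp only [TriState.monicRound, h1, premSet]
    ext P
    by_cases hP : P = Q <;> simp [hP, hQPS]
  refine ⟨by simp [TriState.monicRound, h1, premSet], ⟨h2 ▸ h.tri, fun P hP => ?_⟩⟩
  rcases Finset.mem_insert.1 hP with rfl | hP
  · omega
  · exact h.above P hP

end Top

theorem TriState.bound_le {a l d k d' k' : ℕ} (T : TriState n)
    (hb : bitBound l d k ≤ bitBound l d' k') (hc : callBound l d k ≤ callBound l d' k') :
    T.bound a l d k ≤ T.bound a l d' k' := by
  unfold TriState.bound
  gcongr

/-- What one round keeps: the invariant, and the bound for the cost that remains. -/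
def RoundKeeps (a l d k : ℕ) (T : TriState n) (b : ℕ) (T' : TriState n) : Prop :=
  ∃ d' k', T'.Inv l d' k' ∧
    (∀ S ∈ T'.PStar, S ∈ T.PStar ∨ ∃ d k, TriangularAbove l d k S) ∧
    a + b + T'.bound a l d' k' + ∑ S ∈ T'.PStar, weight a l S ≤
      T.bound a l d k + ∑ S ∈ T.PStar, weight a l S

theorem roundKeeps_monic_top {a l k : ℕ} {v : Fin n} {T : TriState n} {Q : BoolPoly n}
    (h : T.Inv l ((v : ℕ) + 1) k) (htop : ∀ P ∈ T.PS, cls P ≤ (v : ℕ) + 1)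
    (hQ : Q ∈ classPart T.PS ((v : ℕ) + 1)) (hI : lead v Q = one) :
    RoundKeeps a l ((v : ℕ) + 1) k T (T.monicRound v Q).bits (T.monicRound v Q).val := by
  refine ⟨v, l, h.monicRound htop hQ hI, fun S hS => Or.inl hS, ?_⟩
  have hh := height_lt_height hQ (cls_le_of_mem_monicRound (Q := Q) htop)
  have hbits := bits_monicRound_le hQ
  have hb : (T.monicRound v Q).bits + bitBound l v l ≤ bitBound l ((v : ℕ) + 1) k := by
    obtain hv | ⟨e, he⟩ : (v : ℕ) = 0 ∨ ∃ e, (v : ℕ) = e + 1 :=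
      (Nat.eq_zero_or_eq_succ_pred _).imp_right fun h => ⟨_, h⟩
    -- In class one at most one remainder is computed, at cost `3 * 4 ^ 0`; this is the value of
    -- `bitBound l 1`.
    · have := card_classPart_one_le v hv T.PS
      rw [hv, zero_add] at hbits ⊢
      simp only [bitBound]
      omega
    · have h1 := h.card_classPart_le
      have h2 : (classPart T.PS ((v : ℕ) + 1)).card ≤ l :=
        (Finset.card_filter_le _ _).trans (h.card_PS_le htop)
      have h3 := Finset.card_pos.2 ⟨Q, hQ⟩
      obtain ⟨k, rfl⟩ : ∃ k', k = k' + 1 := ⟨k - 1, by omega⟩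
      have h4 : ((classPart T.PS ((v : ℕ) + 1)).card - 1) * (3 * 4 ^ (v : ℕ)) ≤
          l * (5 * 4 ^ (v : ℕ)) :=
        Nat.mul_le_mul ((Nat.sub_le _ _).trans h2) (Nat.mul_le_mul_right _ (by norm_num))
      rw [he] at hbits h4 ⊢
      rw [bitBound_succ_right]
      have h5 : 5 * 4 ^ (e + 1) * l = l * (5 * 4 ^ (e + 1)) := by ring
      omega
  have hc : callBound l v l ≤ callBound l ((v : ℕ) + 1) k := callBound_le_succ _ _ _
  have hm : a * ((n + 2) * (callBound l v l - 1) + height (T.monicRound v Q).val.PS + 1) + a ≤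
      a * ((n + 2) * (callBound l ((v : ℕ) + 1) k - 1) + height T.PS + 1) := by
    rw [← mul_add_one]
    have : (n + 2) * (callBound l v l - 1) ≤ (n + 2) * (callBound l ((v : ℕ) + 1) k - 1) := by
      gcongr
    exact Nat.mul_le_mul_left a (by omega)
  change _ + ∑ S ∈ T.PStar, weight a l S ≤ _
  unfold TriState.bound
  omega

theorem roundKeeps_split_top {a l k : ℕ} {v : Fin n} {T : TriState n} {Q : BoolPoly n}
    (h : T.Inv l ((v : ℕ) + 1) k) (htop : ∀ P ∈ T.PS, cls P ≤ (v : ℕ) + 1)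
    (hQ : Q ∈ classPart T.PS ((v : ℕ) + 1)) (hI : lead v Q ≠ one) :
    RoundKeeps a l ((v : ℕ) + 1) k T (T.splitRound v Q).bits (T.splitRound v Q).val := by
  have h1 := h.card_classPart_le
  have h2 : (classPart T.PS ((v : ℕ) + 1)).card ≤ l :=
    (Finset.card_filter_le _ _).trans (h.card_PS_le htop)
  have h3 := Finset.card_pos.2 ⟨Q, hQ⟩
  obtain ⟨k, rfl⟩ : ∃ k', k = k' + 1 := ⟨k - 1, by omega⟩
  -- Splitting is impossible in the lowest variable, so the recursive case of the bounds applies.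
  obtain ⟨e, he⟩ : ∃ e, (v : ℕ) = e + 1 := by
    refine Nat.exists_eq_succ_of_ne_zero fun hv => hI ?_
    exact lead_eq_one_of_cls_eq_one hv (by rw [(Finset.mem_filter.1 hQ).2, hv])
  have hF := cls_joint_le v (lead v Q) (rest v Q)
  have hS := h.triangularAbove_split htop hQ hF
  refine ⟨v, l, h.splitRound htop hQ, fun S hS' => ?_, ?_⟩
  · rcases Finset.mem_insert.1 hS' with rfl | hS'
    · exact Or.inr ⟨_, _, hS⟩
    · exact Or.inl hS'
  have hh := height_lt_height hQ (cls_le_of_mem_splitRound (Q := Q) htop)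
  have hbits := bits_splitRound_le hQ
  have hw := weight_le (a := a) hS
  have hsum := Finset.sum_insert_le_nat (weight a l)
    (T.PS.erase Q ∪ T.A ∪ {(joint v (lead v Q) (rest v Q)).val}) T.PStar
  change _ + ∑ S ∈ insert _ T.PStar, weight a l S ≤ _
  have h4 : (classPart T.PS ((v : ℕ) + 1)).card * (5 * 4 ^ (v : ℕ)) ≤ l * (5 * 4 ^ (v : ℕ)) :=
    Nat.mul_le_mul_right _ h2
  have h5 : 5 * 4 ^ (e + 1) * l = l * (5 * 4 ^ (e + 1)) := by ring
  have hb := bitBound_succ_right l e k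
  have hc := callBound_succ_right l e k
  have hp := callBound_pos l (e + 1) l
  have hm : a * ((n + 2) * (callBound l (e + 1) l - 1) + height (T.splitRound v Q).val.PS + 1)
      + a + a * (n + 2) * callBound l (e + 2) k ≤
      a * ((n + 2) * (callBound l (e + 2) (k + 1) - 1) + height T.PS + 1) := by
    -- The `- 1` stands for the running call, which continues in the eliminated set; the split-off
    -- set brings its full number of calls.
    have : callBound l (e + 2) (k + 1) - 1 = callBound l (e + 2) k + (callBound l (e + 1) l - 1) := by
      omega
    rw [this, mul_assoc, ← mul_add_one, ← mul_add]
    refine Nat.mul_le_mul_left a ?_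
    rw [mul_add]
    omega
  unfold setBound at hw
  unfold TriState.bound
  rw [he] at *
  rw [show e + 1 + 1 = e + 2 from rfl] at *
  omega

/-- The class treated is compared with `d`. Below `d` the invariant is first lowered to that class,
and at `d` the recursion applies. Above `d` the round is free of bits and cannot split, and the drop
in height pays for the step. -/
theorem TriStep.roundKeeps {a l d k b : ℕ} {T T' : TriState n} (hT : TriStep T b T')
    (h : T.Inv l d k) : RoundKeeps a l d k T b T' := by
  have lower : ∀ {v : Fin n} {b : ℕ} {T' : TriState n}, (v : ℕ) + 1 < d →
      RoundKeeps a l ((v : ℕ) + 1) l T b T' → RoundKeeps a l d k T b T' := by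
    rintro v b T' hd ⟨d', k', h1, h2, h3⟩
    exact ⟨d', k', h1, h2, h3.trans (Nat.add_le_add_right
      (T.bound_le (bitBound_le l k hd) (callBound_le l k hd)) _)⟩
  cases hT with
  | monic v Q hone htop hQ hI =>
    rcases lt_trichotomy ((v : ℕ) + 1) d with hd | rfl | hd
    · exact lower hd (roundKeeps_monic_top (h.lower hd.le htop) htop hQ hI)
    · exact roundKeeps_monic_top h htop hQ hI
    · obtain ⟨h1, h2⟩ := h.monicRound_above hd hQ
      refine ⟨d, k, h2, fun S hS => Or.inl hS, ?_⟩
      have hh := height_lt_height hQ (cls_le_of_mem_monicRound (Q := Q) htop)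
      rw [h1]
      refine Nat.add_le_add_right ?_ _
      unfold TriState.bound
      have : a * ((n + 2) * (callBound l d k - 1) + height (T.monicRound v Q).val.PS + 1) + a ≤
          a * ((n + 2) * (callBound l d k - 1) + height T.PS + 1) := by
        rw [← mul_add_one]
        exact Nat.mul_le_mul_left a (by omega)
      omega
  | split v Q hone htop hQ hI =>
    rcases lt_trichotomy ((v : ℕ) + 1) d with hd | rfl | hd
    · exact lower hd (roundKeeps_split_top (h.lower hd.le htop) htop hQ hI)
    · exact roundKeeps_split_top h htop hQ hI
    · obtain ⟨hQPS, hQc⟩ := Finset.mem_filter.1 hQ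
      exact absurd (h.tri.monic v (by omega) Q (Finset.mem_union_left _ hQPS) hQc) hI

/-! ### Runs of `TDCS₂` -/

/-- Invariant of the memory of `TDCS₂`: the cost that remains is bounded by `w`. -/
def CSState.Inv (a l : ℕ) (s : CSState n) (w : ℕ) : Prop :=
  (∀ S ∈ s.pending, ∃ d k, TriangularAbove l d k S) ∧
  match s.current with
  | none => ∑ S ∈ s.pending, weight a l S ≤ w
  | some T => ∃ d k, T.Inv l d k ∧ (∀ S ∈ T.PStar, ∃ d k, TriangularAbove l d k S) ∧
      ∑ S ∈ s.pending, weight a l S + (T.bound a l d k + ∑ S ∈ T.PStar, weight a l S) ≤ w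

theorem CSStep.inv {a l b w : ℕ} {s s' : CSState n} (h : CSStep s b s') (hs : s.Inv a l w) :
    ∃ w', s'.Inv a l w' ∧ a + b + w' ≤ w := by
  cases h with
  | call pending out QS hQS =>
    obtain ⟨hp, hw⟩ := hs
    obtain ⟨d, k, hdk, hweight⟩ := exists_setBound_eq_weight a (hp QS hQS).choose_spec.choose_spec
    have hsum := Finset.add_sum_erase pending (weight a l) hQS
    refine ⟨w - a, ⟨fun S hS => hp S (Finset.mem_of_mem_erase hS), d, k,
      ⟨by simpa using hdk, by simp⟩, by simp, ?_⟩, ?_⟩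
    all_goals
      have hc := callBound_pos l d k
      obtain ⟨c, hc'⟩ : ∃ c, callBound l d k = c + 1 := ⟨_, (Nat.succ_pred_eq_of_pos hc).symm⟩
      have hh := Nat.mul_le_mul_left a (height_le QS)
      -- Of the `n + 2` steps allotted to this call, one is spent now, and one is kept for the
      -- return. The other `n` cover the rounds, as the height is at most `n`.
      have e1 : a * (n + 2) * (c + 1) = a * ((n + 2) * c) + a * n + a + a := by ring
      have e2 : a * ((n + 2) * c + height QS + 1) = a * ((n + 2) * c) + a * height QS + a := by
        ring
      unfold setBound at hweight
      rw [hc', e1] at hweight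
      dsimp only at hw
    · dsimp only
      unfold TriState.bound
      rw [hc', Nat.add_sub_cancel, e2, Finset.sum_empty]
      omega
    · omega
  | round pending out T T' b hT =>
    obtain ⟨hp, d, k, hT1, hstar, hw⟩ := hs
    obtain ⟨d', k', h1, h2, h3⟩ := hT.roundKeeps (a := a) hT1
    refine ⟨w - (a + b), ⟨hp, d', k', h1, fun S hS => (h2 S hS).elim (hstar S) id, ?_⟩, ?_⟩
    all_goals
      dsimp only at hw ⊢
      omega
  | ret pending out T A hT =>
    obtain ⟨hp, d, k, hT1, hstar, hw⟩ := hs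
    refine ⟨w - a, ⟨fun S hS => (Finset.mem_union.1 hS).elim (hp S) (hstar S), ?_⟩, ?_⟩
    all_goals
      -- The summand `1` in `TriState.bound` pays for the return. Sets both pending and split off
      -- merge, which only lowers the sum of the weights.
      have h1 : a ≤ T.bound a l d k :=
        (Nat.le_mul_of_pos_right a (Nat.succ_pos _)).trans (Nat.le_add_left _ _)
      have h2 := Finset.sum_union_inter (s₁ := pending) (s₂ := T.PStar) (f := weight a l)
      dsimp only at hw ⊢
      omega

theorem CSRun.inv {a l m t w : ℕ} {s s' : CSState n} (h : CSRun s m t s') (hs : s.Inv a l w) :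
    ∃ w', s'.Inv a l w' ∧ a * m + t + w' ≤ w := by
  induction h with
  | refl => exact ⟨w, hs, by omega⟩
  | tail h h' ih =>
    obtain ⟨w', hw', hle⟩ := ih
    obtain ⟨w'', hw'', hle'⟩ := h'.inv hw'
    refine ⟨w'', hw'', ?_⟩
    rw [mul_add_one]
    omega

theorem CSRun.cost_le (a : ℕ) {PS : Finset (BoolPoly n)} {m t : ℕ} {s : CSState n}
    (h : CSRun (CSState.init PS) m t s) :
    a * m + t ≤ bitBound PS.card n PS.card + a * (n + 2) * callBound PS.card n PS.card := by
  have hPS := triangularAbove_self PS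
  obtain ⟨w', -, hle⟩ := h.inv (a := a) (l := PS.card)
    (w := setBound n a PS.card n PS.card)
    ⟨fun S hS => ⟨n, PS.card, by rw [Finset.mem_singleton.1 hS]; exact hPS⟩,
      by simpa [CSState.init] using weight_le hPS⟩
  exact (Nat.le_add_right _ _).trans hle

/-! ### Estimates -/

/-- The added term makes the induction close. After multiplication by `l + 1 ≥ 5` it covers both the
new cost, at most one copy of `5 * 4 ^ (d + 2) * (l + 1) ^ 2`, and its own successor, four copies.
-/
theorem bitBound_add_le {l : ℕ} (hl : 4 ≤ l) (d : ℕ) :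
    bitBound l (d + 2) l + 5 * 4 ^ (d + 2) * (l + 1) ^ 2 ≤ 103 * (l + 1) ^ (d + 2) := by
  induction d with
  | zero =>
    -- Here `3 (l + 1) + 20 l² + 80 (l + 1)² ≤ (3 + 20 + 80) (l + 1)²`, whence `103`.
    norm_num [bitBound]
    nlinarith
  | succ d ih =>
    rw [show d + 1 + 2 = d + 3 from rfl, bitBound]
    have h1 := Nat.mul_le_mul_left (l + 1) ih
    have h2 : 5 * 4 ^ (d + 2) * (l + 1) ^ 2 * 5 ≤ 5 * 4 ^ (d + 2) * (l + 1) ^ 2 * (l + 1) :=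
      Nat.mul_le_mul_left _ (by omega)
    have h3 : 5 * 4 ^ (d + 2) * (l * l) ≤ 5 * 4 ^ (d + 2) * (l + 1) ^ 2 :=
      Nat.mul_le_mul_left _ (by nlinarith)
    have e1 : (4 : ℕ) ^ (d + 3) = 4 ^ (d + 2) * 4 := pow_succ _ _
    have e2 : (l + 1) ^ (d + 3) = (l + 1) ^ (d + 2) * (l + 1) := pow_succ _ _
    rw [show d + 1 + 1 = d + 2 from rfl, e1, e2]
    nlinarith

theorem bitBound_le_pow {l : ℕ} (hl : 4 ≤ l) (n : ℕ) : bitBound l n l ≤ 103 * (l + 1) ^ n := by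
  rcases n with _ | _ | d
  · simp [bitBound]
  · simp only [bitBound, zero_add, pow_one]
    omega
  · exact (Nat.le_add_right _ _).trans (bitBound_add_le hl d)

/-- For `n ≥ 1` the number of calls is bounded by `(l + 1) ^ (n - 1)`, as class one never splits.
The spare factor `l + 1` absorbs the `n + 2` steps per call. -/
theorem callBound_mul_le {κ l n : ℕ} (h : n ≤ κ * l) :
    (n + 2) * callBound l n l ≤ (κ + 2) * (l + 1) ^ n := by
  have h1 : n + 2 ≤ (κ + 2) * (l + 1) := by nlinarith
  rcases n with _ | _ | d
  · simp [callBound]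
  · simpa [callBound] using h1
  · rw [callBound]
    calc (d + 2 + 2) * ((l + 1) * (l + 1) ^ d)
        ≤ (κ + 2) * (l + 1) * ((l + 1) * (l + 1) ^ d) := Nat.mul_le_mul_right _ h1
      _ = (κ + 2) * (l + 1) ^ (d + 2) := by ring

/-- A bound for `bitBound l n l` for `l < 4` and `n ≤ κ * l`. -/
def smallBound (κ : ℕ) : ℕ :=
  ∑ l ∈ Finset.range 4, ∑ n ∈ Finset.range (κ * 3 + 1), bitBound l n l

theorem bitBound_le_smallBound {κ l n : ℕ} (hl : l < 4) (h : n ≤ κ * l) :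
    bitBound l n l ≤ smallBound κ := by
  -- For `l < 4` only finitely many pairs `(l, n)` occur, so their sum is a uniform bound.
  have hn : n < κ * 3 + 1 := by
    have := Nat.mul_le_mul_left κ (Nat.le_of_lt_succ hl)
    omega
  exact (Finset.single_le_sum (f := fun n => bitBound l n l) (fun _ _ => Nat.zero_le _)
    (Finset.mem_range.2 hn)).trans
    (Finset.single_le_sum
      (f := fun l => ∑ n ∈ Finset.range (κ * 3 + 1), bitBound l n l)
      (fun _ _ => Nat.zero_le _) (Finset.mem_range.2 hl))

theorem bitBound_le_mul_pow {κ l n : ℕ} (h : n ≤ κ * l) :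
    bitBound l n l ≤ (103 + smallBound κ) * (l + 1) ^ n := by
  have h1 : 1 ≤ (l + 1) ^ n := Nat.one_le_pow _ _ (Nat.succ_pos l)
  rcases lt_or_ge l 4 with hl | hl
  · have := bitBound_le_smallBound hl h
    nlinarith [Nat.mul_le_mul_left (103 + smallBound κ) h1]
  · exact (bitBound_le_pow hl n).trans (Nat.mul_le_mul_right _ (Nat.le_add_right _ _))

/-! ### From powers of `l + 1` to powers of `l`, and the final bounds. -/

theorem add_one_pow_le_exp_mul_pow {κ l n : ℕ} (h : n ≤ κ * l) :
    ((l : ℝ) + 1) ^ n ≤ Real.exp κ * (l : ℝ) ^ n := by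
  rcases Nat.eq_zero_or_pos l with rfl | hl
  · obtain rfl : n = 0 := by omega
    simp
  · have hl' : (0 : ℝ) < l := Nat.cast_pos.2 hl
    have h1 : (l : ℝ) + 1 ≤ l * Real.exp (l : ℝ)⁻¹ := by
      have := mul_le_mul_of_nonneg_left (Real.add_one_le_exp (l : ℝ)⁻¹) hl'.le
      rwa [mul_add, mul_inv_cancel₀ hl'.ne', mul_one, add_comm] at this
    calc ((l : ℝ) + 1) ^ n ≤ (l * Real.exp (l : ℝ)⁻¹) ^ n := by gcongr
      _ = Real.exp (n * (l : ℝ)⁻¹) * (l : ℝ) ^ n := by rw [mul_pow, ← Real.exp_nat_mul, mul_comm]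
      _ ≤ Real.exp κ * (l : ℝ) ^ n := by
        gcongr
        rw [← div_eq_mul_inv, div_le_iff₀ hl']
        exact_mod_cast h

theorem two_rpow_mul_logb {κ l n : ℕ} (h : n ≤ κ * l) :
    (2 : ℝ) ^ ((n : ℝ) * Real.logb 2 (l : ℝ)) = (l : ℝ) ^ n := by
  rcases Nat.eq_zero_or_pos l with rfl | hl
  · obtain rfl : n = 0 := by omega
    simp
  · rw [mul_comm, Real.rpow_mul (by norm_num), Real.rpow_logb (by norm_num) (by norm_num)
      (Nat.cast_pos.2 hl), Real.rpow_natCast]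

theorem mainTheorem7 :
    (∀ κ : ℕ, ∃ C : ℝ, ∀ (n : ℕ) (PS : Finset (BoolPoly n)), n ≤ κ * PS.card →
      ∀ (m t : ℕ) (s : CSState n), CSRun (CSState.init PS) m t s →
        (m : ℝ) + (t : ℝ) ≤ C * (PS.card : ℝ) ^ n ∧
        (m : ℝ) + (t : ℝ) ≤ C * (2 : ℝ) ^ ((n : ℝ) * Real.logb 2 (PS.card : ℝ))) ∧
    (∃ C : ℝ, ∀ (n : ℕ) (PS : Finset (BoolPoly n)), 4 ≤ PS.card →
      ∀ (m t : ℕ) (s : CSState n), CSRun (CSState.init PS) m t s →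
        (t : ℝ) ≤ C * ((PS.card : ℝ) + 1) ^ n) := by
  constructor
  · intro κ
    refine ⟨(103 + smallBound κ + (κ + 2)) * Real.exp κ, fun n PS hn m t s hrun => ?_⟩
    rw [two_rpow_mul_logb hn, and_self]
    have h1 := hrun.cost_le 1
    have h2 := bitBound_le_mul_pow hn
    have h3 := callBound_mul_le hn
    rw [one_mul, one_mul] at h1
    have h4 : m + t ≤ (103 + smallBound κ + (κ + 2)) * (PS.card + 1) ^ n := by
      rw [add_mul]
      omega
    calc (m : ℝ) + t ≤ (103 + smallBound κ + (κ + 2)) * ((PS.card : ℝ) + 1) ^ n := by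
          exact_mod_cast h4
      _ ≤ (103 + smallBound κ + (κ + 2)) * (Real.exp κ * (PS.card : ℝ) ^ n) := by
          gcongr
          exact add_one_pow_le_exp_mul_pow hn
      _ = _ := (mul_assoc _ _ _).symm
  · refine ⟨103, fun n PS hl m t s hrun => ?_⟩
    have h1 := hrun.cost_le 0
    have h2 := bitBound_le_pow hl n
    have h3 : t ≤ 103 * (PS.card + 1) ^ n := by
      rw [zero_mul, zero_mul, zero_mul] at h1
      omega
    exact_mod_cast h3
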